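/- All graphs are finite and simple. A graph is $3$-connected if it has at least $4$ vertices and any two distinct vertices are joined by three distinct paths that pairwise meet only in their endpoints. A graph $G$ has an $H$-minor if a graph isomorphic to $H$ can be obtained from $G$ by deleting edges, contracting edges (identifying any parallel edges that arise) and removing isolated vertices. \textbf{Corollary.} Let $G$ be a $3$-connected graph that has a $K_{3,4}$-minor or a $K_6$-minor. Then $G$ has a $K_{3,4}$-minor or $G$ is isomorphic to $K_6$. In particular, every $3$-connected graph with a $K_6$-minor either has a $K_{3,4}$-minor or is isomorphic to $K_6$. -/

import Mathlib

namespace SimpleGraph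

universe u w

/-- `G` is `k`-connected: it has at least `k + 1` vertices, and any two distinct vertices are joined
by `k` distinct paths, any two of which meet exactly in their endpoints. -/
def IsKConnected {V : Type u} (G : SimpleGraph V) (k : ℕ) : Prop :=
  k + 1 ≤ Nat.card V ∧
    ∀ x y : V, x ≠ y → ∃ P : Fin k → G.Path x y, Function.Injective P ∧
      ∀ i j : Fin k, i ≠ j → ∀ v : V,
        v ∈ (P i : G.Walk x y).support → v ∈ (P j : G.Walk x y).support → v = x ∨ v = y

/-- The simple graph `G / xy`: the vertices `x` and `y` are deleted and replaced by one new vertex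
`none`, adjacent to every remaining vertex that was adjacent to `x` or to `y`. Parallel edges are
identified and the contracted edge disappears. -/
def contractEdge {V : Type u} (G : SimpleGraph V) (x y : V) :
    SimpleGraph (Option {v : V // v ≠ x ∧ v ≠ y}) where
  Adj a b :=
    match a, b with
    | some a, some b => G.Adj a b
    | some a, none => G.Adj a x ∨ G.Adj a y
    | none, some b => G.Adj b x ∨ G.Adj b y
    | none, none => False
  symm := ⟨by
    rintro (_ | a) (_ | b) h
    · exact h
    · exact h
    · exact h
    · exact G.adj_symm h⟩
  loopless := ⟨by
    rintro (_ | a) h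
    · exact h
    · exact G.irrefl h⟩

/-- `H.IsMinor G`: a graph isomorphic to `H` can be obtained from `G` by a finite sequence of edge
deletions, edge contractions and removals of isolated vertices. -/
inductive IsMinor {W : Type w} (H : SimpleGraph W) : ∀ {V : Type u}, SimpleGraph V → Prop
  | of_iso {V : Type u} {G : SimpleGraph V} (h : Nonempty (G ≃g H)) : IsMinor H G
  | deleteEdge {V : Type u} {G : SimpleGraph V} (x y : V) (hxy : G.Adj x y)
      (h : IsMinor H (G.deleteEdges {s(x, y)})) : IsMinor H G
  | contractEdge {V : Type u} {G : SimpleGraph V} (x y : V) (hxy : G.Adj x y)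
      (h : IsMinor H (G.contractEdge x y)) : IsMinor H G
  | deleteIsolated {V : Type u} {G : SimpleGraph V} (v : V) (hv : ∀ u, ¬ G.Adj v u)
      (h : IsMinor H (G.induce {u : V | u ≠ v})) : IsMinor H G

end SimpleGraph

/-! A `K₆`-minor is handled as a partition of the vertices into six connected, pairwise adjacent
branch sets (`IsMinor.exists_isModel`, `IsModel.exists_spanning`). Suppose there is no `K₃,₄`-minor.
If a branch set is divided into two connected parts, then one part is joined to at most one of the
five other branch sets (`IsModel.isMinor_or_card_le_one`).

Take a model with a branch set `B` as large as possible. `B` has at most one neighbour in each other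
branch set, for otherwise a piece of that set could be moved into `B` (`IsModel.neighbor_unique`).
If `B` had two vertices, it would contain a part `C` with at most one neighbour in the rest of `B`
and joined to at most one other branch set (`IsModel.exists_part`). So at most two vertices would
separate `C` from the rest, against 3-connectedness. Hence the largest branch set, and so every
branch set, is a single vertex, and `G` is `K₆`. -/

namespace SimpleGraph

universe u w

/-! ### Connected vertex sets -/

variable {V : Type u} {W : Type w}

/-- A vertex set is connected if it is nonempty and every cut of it is crossed by an edge. -/
def SetConnected (G : SimpleGraph V) (S : Set V) : Prop :=
  S.Nonempty ∧ ∀ A : Set V, (∃ a ∈ S, a ∈ A) → (∃ b ∈ S, b ∉ A) →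
    ∃ a ∈ S, ∃ b ∈ S, a ∈ A ∧ b ∉ A ∧ G.Adj a b

/-- Some edge of `G` joins `A` to `B`. -/
def Sees (G : SimpleGraph V) (A B : Set V) : Prop :=
  ∃ a ∈ A, ∃ b ∈ B, G.Adj a b

/-- The sets `B w` are connected, and they are joined by edges of `G` wherever `H` demands it. -/
def IsModel (H : SimpleGraph W) (G : SimpleGraph V) (B : W → Set V) : Prop :=
  (∀ w, G.SetConnected (B w)) ∧ ∀ w w', H.Adj w w' → G.Sees (B w) (B w')

theorem Sees.symm {G : SimpleGraph V} {A B : Set V} (h : G.Sees A B) : G.Sees B A := by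
  obtain ⟨a, ha, b, hb, hab⟩ := h
  exact ⟨b, hb, a, ha, hab.symm⟩

theorem Sees.mono {G : SimpleGraph V} {A B A' B' : Set V} (h : G.Sees A B) (hA : A ⊆ A')
    (hB : B ⊆ B') : G.Sees A' B' := by
  obtain ⟨a, ha, b, hb, hab⟩ := h
  exact ⟨a, hA ha, b, hB hb, hab⟩

theorem sees_union_left {G : SimpleGraph V} {A A' B : Set V} :
    G.Sees (A ∪ A') B ↔ G.Sees A B ∨ G.Sees A' B := by
  constructor
  · rintro ⟨a, ha | ha, b, hb, hab⟩
    · exact Or.inl ⟨a, ha, b, hb, hab⟩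
    · exact Or.inr ⟨a, ha, b, hb, hab⟩
  · rintro (h | h)
    · exact h.mono Set.subset_union_left subset_rfl
    · exact h.mono Set.subset_union_right subset_rfl

theorem SetConnected.sees_diff {G : SimpleGraph V} {S A : Set V} (hS : G.SetConnected S)
    (hAS : A ⊆ S) (hA : A.Nonempty) (hA' : (S \ A).Nonempty) : G.Sees A (S \ A) := by
  obtain ⟨a, ha⟩ := hA
  obtain ⟨b, hb⟩ := hA'
  obtain ⟨x, -, y, hy, hxA, hyA, hxy⟩ := hS.2 A ⟨a, hAS ha, ha⟩ ⟨b, hb.1, hb.2⟩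
  exact ⟨x, hxA, y, ⟨hy, hyA⟩, hxy⟩

theorem setConnected_singleton (G : SimpleGraph V) (v : V) : G.SetConnected {v} := by
  refine ⟨⟨v, rfl⟩, ?_⟩
  rintro A ⟨a, rfl, ha⟩ ⟨b, rfl, hb⟩
  exact absurd ha hb

theorem SetConnected.union {G : SimpleGraph V} {S T : Set V} (hS : G.SetConnected S)
    (hT : G.SetConnected T) (h : G.Sees S T) : G.SetConnected (S ∪ T) := by
  refine ⟨hS.1.mono Set.subset_union_left, ?_⟩
  rintro A ⟨a, ha, haA⟩ ⟨b, hb, hbA⟩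
  by_contra hcon
  push Not at hcon
  have side : ∀ R, R ⊆ S ∪ T → G.SetConnected R → (∀ r ∈ R, r ∈ A) ∨ ∀ r ∈ R, r ∉ A := by
    intro R hR hc
    by_contra! hne
    obtain ⟨⟨p, hp, hpA⟩, q, hq, hqA⟩ := hne
    obtain ⟨x, hx, y, hy, hxA, hyA, hxy⟩ := hc.2 A ⟨q, hq, hqA⟩ ⟨p, hp, hpA⟩
    exact hcon x (hR hx) y (hR hy) hxA hyA hxy
  obtain ⟨s, hs, t, ht, hst⟩ := h
  rcases side S Set.subset_union_left hS with h1 | h1 <;>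
    rcases side T Set.subset_union_right hT with h2 | h2
  · exact hbA (hb.elim (h1 b) (h2 b))
  · exact hcon s (Or.inl hs) t (Or.inr ht) (h1 s hs) (h2 t ht) hst
  · exact hcon t (Or.inr ht) s (Or.inl hs) (h2 t ht) (h1 s hs) hst.symm
  · exact ha.elim (fun h => h1 a h haA) fun h => h2 a h haA

/-- A connected set can be divided into two connected sets separating two given vertices. -/
theorem SetConnected.exists_split [Finite V] {G : SimpleGraph V} {S : Set V}
    (hS : G.SetConnected S) {u v : V} (hu : u ∈ S) (hv : v ∈ S) (huv : u ≠ v) :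
    ∃ C ⊆ S, u ∈ C ∧ v ∉ C ∧ G.SetConnected C ∧ G.SetConnected (S \ C) := by
  -- Take `C` maximal. If no edge crossed a cut `A ∋ v` of `S \ C`, then `S \ A ∪ C` would be a
  -- larger candidate.
  obtain ⟨C, ⟨hCS, huC, hvC, hC⟩, hmax⟩ := Set.Finite.exists_maximal
    (s := {C : Set V | C ⊆ S ∧ u ∈ C ∧ v ∉ C ∧ G.SetConnected C}) (Set.toFinite _)
    ⟨{u}, by simpa using hu, rfl, fun h => huv h.symm, setConnected_singleton G u⟩
  refine ⟨C, hCS, huC, hvC, hC, ⟨v, hv, hvC⟩, ?_⟩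
  suffices key : ∀ A : Set V, v ∈ A → (∃ b ∈ S \ C, b ∉ A) →
      ∃ a ∈ S \ C, ∃ b ∈ S \ C, a ∈ A ∧ b ∉ A ∧ G.Adj a b by
    rintro A ⟨a, ha, haA⟩ ⟨b, hb, hbA⟩
    by_cases hvA : v ∈ A
    · exact key A hvA ⟨b, hb, hbA⟩
    · obtain ⟨p, hp, q, hq, hpA, hqA, hpq⟩ := key Aᶜ hvA ⟨a, ha, fun h => h haA⟩
      exact ⟨q, hq, p, hp, not_not.mp hqA, hpA, hpq.symm⟩
  rintro A hvA ⟨b, hb, hbA⟩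
  by_contra! hcon
  have hconn : G.SetConnected (S \ A ∪ C) := by
    refine ⟨⟨u, Or.inr huC⟩, ?_⟩
    suffices key : ∀ X : Set V, C ⊆ X → (∃ b ∈ S \ A ∪ C, b ∉ X) →
        ∃ a ∈ S \ A ∪ C, ∃ b ∈ S \ A ∪ C, a ∈ X ∧ b ∉ X ∧ G.Adj a b by
      rintro X ⟨p, hp, hpX⟩ ⟨q, hq, hqX⟩
      by_cases h1 : C ⊆ X
      · exact key X h1 ⟨q, hq, hqX⟩
      · obtain ⟨c, hc, hcX⟩ := Set.not_subset.mp h1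
        by_cases h2 : C ⊆ Xᶜ
        · obtain ⟨a, ha, b, hb, haX, hbX, hab⟩ := key Xᶜ h2 ⟨p, hp, fun h => h hpX⟩
          exact ⟨b, hb, a, ha, not_not.mp hbX, haX, hab.symm⟩
        · obtain ⟨d, hd, hdX⟩ := Set.not_subset.mp h2
          obtain ⟨a, ha, b, hb, h⟩ := hC.2 X ⟨d, hd, not_not.mp hdX⟩ ⟨c, hc, hcX⟩
          exact ⟨a, Or.inr ha, b, Or.inr hb, h⟩
    rintro X hCX ⟨q, hq, hqX⟩
    have hqS : q ∈ S \ A := hq.resolve_right fun h => hqX (hCX h)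
    -- An edge of `S` enters `(S \ A) \ X`. It cannot start in `A \ C`, since no edge crosses the
    -- cut `A` of `S \ C`.
    obtain ⟨a, ha, b, hb, haY, hbY, hab⟩ := hS.2 ((S \ A) \ X)ᶜ ⟨u, hu, fun h => h.2 (hCX huC)⟩
      ⟨q, hqS.1, fun h => h ⟨hqS, hqX⟩⟩
    have hb' : b ∈ (S \ A) \ X := not_not.mp hbY
    have ha' : a ∈ S \ A ∪ C := by
      by_contra h
      have haA : a ∈ A := by
        by_contra h'
        exact h (Or.inl ⟨ha, h'⟩)
      exact hcon a ⟨ha, fun h' => h (Or.inr h')⟩ b ⟨hb, fun h' => hb'.2 (hCX h')⟩ haA hb'.1.2 hab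
    refine ⟨a, ha', b, Or.inl hb'.1, ?_, hb'.2, hab⟩
    by_contra haX
    exact haY ⟨ha'.resolve_right fun h => haX (hCX h), haX⟩
  have := hmax ⟨Set.union_subset Set.sdiff_subset hCS, Or.inr huC,
    fun h => h.elim (fun h => h.2 hvA) hvC, hconn⟩ Set.subset_union_right
  exact hb.2 (this (Or.inl ⟨hb.1, hbA⟩))

/-! ### Connectedness and adjacency under edge contraction -/

section Contraction

variable (G : SimpleGraph V) (x y : V)

open Classical in
/-- The projection of the vertices of `G` onto those of `G.contractEdge x y`. -/
noncomputable def contractProj (v : V) : Option {v : V // v ≠ x ∧ v ≠ y} :=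
  if h : v ≠ x ∧ v ≠ y then some ⟨v, h⟩ else none

theorem contractProj_left : contractProj x y x = none := by simp [contractProj]

theorem contractProj_right : contractProj x y y = none := by simp [contractProj]

theorem contractProj_coe (v : {v : V // v ≠ x ∧ v ≠ y}) : contractProj x y v = some v := by
  simp [contractProj, v.2]

theorem contractProj_surjective : Function.Surjective (contractProj x y) := by
  rintro (_ | v)
  · exact ⟨x, contractProj_left x y⟩
  · exact ⟨v, contractProj_coe x y v⟩

variable {x y}

theorem contractProj_eq_none {v : V} (h : contractProj x y v = none) : v = x ∨ v = y := by
  by_contra! h'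
  simp [contractProj, h'] at h

theorem contractProj_eq_some {v : V} {z : {v : V // v ≠ x ∧ v ≠ y}}
    (h : contractProj x y v = some z) : v = z := by
  unfold contractProj at h
  split_ifs at h
  simpa using congrArg Subtype.val (Option.some.inj h)

theorem exists_adj_of_contractEdge_adj {a b : Option {v : V // v ≠ x ∧ v ≠ y}}
    (h : (G.contractEdge x y).Adj a b) :
    ∃ u v, contractProj x y u = a ∧ contractProj x y v = b ∧ G.Adj u v := by
  rcases a with _ | a <;> rcases b with _ | b
  · exact h.elim
  · rcases h with h | h
    · exact ⟨x, b, contractProj_left x y, contractProj_coe x y b, G.adj_symm h⟩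
    · exact ⟨y, b, contractProj_right x y, contractProj_coe x y b, G.adj_symm h⟩
  · rcases h with h | h
    · exact ⟨a, x, contractProj_coe x y a, contractProj_left x y, h⟩
    · exact ⟨a, y, contractProj_coe x y a, contractProj_right x y, h⟩
  · exact ⟨a, b, contractProj_coe x y a, contractProj_coe x y b, h⟩

theorem contractEdge_adj_of_adj {u v : V} (h : G.Adj u v)
    (hne : contractProj x y u ≠ contractProj x y v) :
    (G.contractEdge x y).Adj (contractProj x y u) (contractProj x y v) := by
  rcases hu : contractProj x y u with _ | a <;> rcases hv : contractProj x y v with _ | b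
  · exact absurd (hu.trans hv.symm) hne
  · obtain rfl := contractProj_eq_some hv
    rcases contractProj_eq_none hu with rfl | rfl
    · exact Or.inl h.symm
    · exact Or.inr h.symm
  · obtain rfl := contractProj_eq_some hu
    rcases contractProj_eq_none hv with rfl | rfl
    · exact Or.inl h
    · exact Or.inr h
  · obtain rfl := contractProj_eq_some hu
    obtain rfl := contractProj_eq_some hv
    exact h

theorem SetConnected.preimage_contractProj {S : Set (Option {v : V // v ≠ x ∧ v ≠ y})}
    (hxy : G.Adj x y) (hS : (G.contractEdge x y).SetConnected S) :
    G.SetConnected (contractProj x y ⁻¹' S) := by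
  refine ⟨hS.1.preimage (contractProj_surjective x y), ?_⟩
  rintro A ⟨a, ha, haA⟩ ⟨b, hb, hbA⟩
  by_contra! hcon
  -- Only `x` and `y` share an image, and the edge `xy` keeps them on the same side of an uncrossed
  -- cut.
  have same : ∀ u v, contractProj x y u ∈ S → contractProj x y u = contractProj x y v →
      u ∈ A → v ∈ A := by
    intro u v hu huv huA
    rcases hu' : contractProj x y u with _ | z
    · by_contra hvA
      refine hcon u hu v (by rwa [Set.mem_preimage, ← huv]) huA hvA ?_
      rcases contractProj_eq_none hu' with rfl | rfl <;>
        rcases contractProj_eq_none (huv.symm.trans hu') with rfl | rfl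
      · exact absurd huA hvA
      · exact hxy
      · exact hxy.symm
      · exact absurd huA hvA
    · rwa [contractProj_eq_some (huv.symm.trans hu'), ← contractProj_eq_some hu']
  obtain ⟨p, hp, q, hq, ⟨p', hp', rfl⟩, hqA, hpq⟩ := hS.2 (contractProj x y '' A)
    ⟨_, ha, a, haA, rfl⟩ ⟨_, hb, fun ⟨c, hcA, hc⟩ => hbA (same c b (by rwa [hc]) hc hcA)⟩
  obtain ⟨u, v, hu, rfl, huv⟩ := exists_adj_of_contractEdge_adj G hpq
  exact hcon u (by rwa [Set.mem_preimage, hu]) v hq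
    (same p' u hp hu.symm hp') (fun h => hqA ⟨v, h, rfl⟩) huv

theorem SetConnected.of_preimage_contractProj {S : Set (Option {v : V // v ≠ x ∧ v ≠ y})}
    (hS : G.SetConnected (contractProj x y ⁻¹' S)) : (G.contractEdge x y).SetConnected S := by
  obtain ⟨v, hv⟩ := hS.1
  refine ⟨⟨_, hv⟩, ?_⟩
  rintro A ⟨a, ha, haA⟩ ⟨b, hb, hbA⟩
  obtain ⟨a, rfl⟩ := contractProj_surjective x y a
  obtain ⟨b, rfl⟩ := contractProj_surjective x y b
  obtain ⟨p, hp, q, hq, hpA, hqA, hpq⟩ := hS.2 (contractProj x y ⁻¹' A) ⟨a, ha, haA⟩ ⟨b, hb, hbA⟩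
  exact ⟨_, hp, _, hq, hpA, hqA, contractEdge_adj_of_adj G hpq
    fun h => hqA (show contractProj x y q ∈ A from h ▸ hpA)⟩

end Contraction

theorem Sees.preimage_contractProj {G : SimpleGraph V} {x y : V}
    {S T : Set (Option {v : V // v ≠ x ∧ v ≠ y})} (h : (G.contractEdge x y).Sees S T) :
    G.Sees (contractProj x y ⁻¹' S) (contractProj x y ⁻¹' T) := by
  obtain ⟨a, ha, b, hb, hab⟩ := h
  obtain ⟨u, v, rfl, rfl, huv⟩ := exists_adj_of_contractEdge_adj G hab
  exact ⟨u, ha, v, hb, huv⟩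

theorem Sees.of_preimage_contractProj {G : SimpleGraph V} {x y : V}
    {S T : Set (Option {v : V // v ≠ x ∧ v ≠ y})} (hST : Disjoint S T)
    (h : G.Sees (contractProj x y ⁻¹' S) (contractProj x y ⁻¹' T)) :
    (G.contractEdge x y).Sees S T := by
  obtain ⟨u, hu, v, hv, huv⟩ := h
  exact ⟨_, hu, _, hv, contractEdge_adj_of_adj G huv fun h => Set.disjoint_left.mp hST hu (h ▸ hv)⟩

/-! ### Minors and models -/

/-- Branch sets given as fibres of a function are automatically disjoint; the value `none` marks
unused vertices. -/
theorem IsMinor.exists_isModel {H : SimpleGraph W} {G : SimpleGraph V} (h : H.IsMinor G) :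
    ∃ f : V → Option W, H.IsModel G fun w => {v | f v = some w} := by
  induction h with
  | @of_iso V G h =>
    obtain ⟨e⟩ := h
    refine ⟨fun v => some (e v), fun w => ?_, fun w w' hw => ?_⟩
    · convert setConnected_singleton G (e.symm w)
      ext v
      simp [RelIso.eq_symm_apply]
    · exact ⟨e.symm w, by simp, e.symm w', by simp, e.symm.map_adj_iff.mpr hw⟩
  | @deleteEdge V G x y hxy h ih =>
    obtain ⟨f, hf, hf'⟩ := ih
    have hle := G.deleteEdges_le {s(x, y)}
    refine ⟨f, fun w => ⟨(hf w).1, fun A ha hb => ?_⟩, fun w w' hw => ?_⟩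
    · obtain ⟨a, ha, b, hb, haA, hbA, hab⟩ := (hf w).2 A ha hb
      exact ⟨a, ha, b, hb, haA, hbA, hle hab⟩
    · obtain ⟨a, ha, b, hb, hab⟩ := hf' w w' hw
      exact ⟨a, ha, b, hb, hle hab⟩
  | @contractEdge V G x y hxy h ih =>
    obtain ⟨f, hf, hf'⟩ := ih
    exact ⟨f ∘ contractProj x y, fun w => (hf w).preimage_contractProj G hxy,
      fun w w' hw => (hf' w w' hw).preimage_contractProj⟩
  | @deleteIsolated V G v hv h ih =>
    obtain ⟨f, hf, hf'⟩ := ih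
    classical
    let g : V → Option W := fun u => if hu : u ≠ v then f ⟨u, hu⟩ else none
    have hg : ∀ u : {u : V | u ≠ v}, g u = f u := fun u => dif_pos u.2
    have hg' : ∀ w u, g u = some w → ∃ u' : {u : V | u ≠ v}, u'.1 = u ∧ f u' = some w := by
      intro w u hu
      by_cases huv : u ≠ v
      · exact ⟨⟨u, huv⟩, rfl, by rwa [← hg]⟩
      · simp [g, huv] at hu
    refine ⟨g, fun w => ⟨?_, ?_⟩, fun w w' hw => ?_⟩
    · obtain ⟨u, hu⟩ := (hf w).1
      exact ⟨u, (hg u).trans hu⟩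
    · rintro A ⟨a, ha, haA⟩ ⟨b, hb, hbA⟩
      obtain ⟨a, rfl, ha'⟩ := hg' w a ha
      obtain ⟨b, rfl, hb'⟩ := hg' w b hb
      obtain ⟨p, hp, q, hq, hpA, hqA, hpq⟩ :=
        (hf w).2 (Subtype.val ⁻¹' A) ⟨a, ha', haA⟩ ⟨b, hb', hbA⟩
      exact ⟨p, (hg p).trans hp, q, (hg q).trans hq, hpA, hqA, hpq⟩
    · obtain ⟨p, hp, q, hq, hpq⟩ := hf' w w' hw
      exact ⟨p, (hg p).trans hp, q, (hg q).trans hq, hpq⟩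

/-- In a connected graph, a model extends to one whose branch sets cover all vertices. -/
theorem IsModel.exists_spanning [Finite V] {H : SimpleGraph W} {G : SimpleGraph V} [Nonempty W]
    (hG : G.SetConnected Set.univ) {f : V → Option W}
    (hf : H.IsModel G fun w => {v | f v = some w}) :
    ∃ g : V → W, H.IsModel G fun w => {v | g v = w} := by
  induction hn : {v | f v = none}.ncard using Nat.strong_induction_on generalizing f with
  | _ n ih =>
    by_cases hnone : ∃ b, f b = none
    · obtain ⟨b, hb⟩ := hnone
      obtain ⟨w₀⟩ := ‹Nonempty W›
      obtain ⟨a, ha⟩ := (hf.1 w₀).1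
      -- An uncovered vertex `p` adjacent to a covered vertex `q` joins the branch set of `q`.
      obtain ⟨p, -, q, -, hp, hq, hpq⟩ := hG.2 {v | f v = none} ⟨b, trivial, hb⟩
        ⟨a, trivial, fun h => Option.some_ne_none w₀ (ha.symm.trans h)⟩
      obtain ⟨w, hw⟩ := Option.ne_none_iff_exists'.mp hq
      classical
      have hpnone : f p = none := hp
      have key : ∀ w' v, Function.update f p (some w) v = some w' ↔
          f v = some w' ∨ v = p ∧ w = w' := by
        intro w' v
        by_cases hv : v = p
        · subst hv
          simp [hpnone]
        · simp [hv]
      have hmono : ∀ w', {v | f v = some w'} ⊆ {v | Function.update f p (some w) v = some w'} :=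
        fun w' v hv => (key w' v).mpr (Or.inl hv)
      refine ih _ ?_ (f := Function.update f p (some w))
        ⟨fun w' => ?_, fun w' w'' h => (hf.2 w' w'' h).mono (hmono w') (hmono w'')⟩ rfl
      · rw [← hn]
        refine Set.ncard_lt_ncard ⟨fun v hv => ?_, fun h => ?_⟩ (Set.toFinite _)
        · by_cases hvp : v = p
          · subst hvp
            exact hp
          · simpa [hvp] using hv
        · simpa using h hp
      · by_cases hww : w = w'
        · subst hww
          have heq : {v | Function.update f p (some w) v = some w} = {v | f v = some w} ∪ {p} := by
            ext v
            simp [key, or_comm]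
          beta_reduce
          rw [heq]
          exact (hf.1 w).union (setConnected_singleton G p) ⟨q, hw, p, rfl, hpq.symm⟩
        · have heq : {v | Function.update f p (some w) v = some w'} = {v | f v = some w'} := by
            ext v
            simp [key, hww]
          beta_reduce
          rw [heq]
          exact hf.1 w'
    · push Not at hnone
      choose g hg using fun v => Option.ne_none_iff_exists'.mp (hnone v)
      refine ⟨g, ?_⟩
      simpa [hg] using hf

theorem IsMinor.of_bijective [Finite V] {H : SimpleGraph W} {G : SimpleGraph V} (e : V ≃ W)
    (he : ∀ a b, H.Adj (e a) (e b) → G.Adj a b) : H.IsMinor G := by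
  induction hn : G.edgeSet.ncard using Nat.strong_induction_on generalizing G with
  | _ n ih =>
    by_cases h : ∀ a b, G.Adj a b → H.Adj (e a) (e b)
    · exact .of_iso ⟨⟨e, fun {a b} => ⟨he a b, h a b⟩⟩⟩
    · push Not at h
      obtain ⟨a, b, hab, hH⟩ := h
      refine .deleteEdge a b hab (ih _ ?_ (fun c d hcd => ?_) rfl)
      · rw [← hn]
        refine Set.ncard_lt_ncard ⟨edgeSet_mono (G.deleteEdges_le _), fun h => ?_⟩ (Set.toFinite _)
        have := h (show s(a, b) ∈ G.edgeSet from hab)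
        simp at this
      · rw [deleteEdges_adj]
        refine ⟨he c d hcd, fun h => hH ?_⟩
        rcases Sym2.eq_iff.mp h with ⟨rfl, rfl⟩ | ⟨rfl, rfl⟩
        · exact hcd
        · exact hcd.symm

/-- A fibre with two vertices contains an edge, and contracting it leaves a model on fewer vertices.
Once all fibres are singletons, only surplus edges remain to be deleted. -/
theorem IsModel.isMinor [Finite V] {H : SimpleGraph W} {G : SimpleGraph V} {g : V → W}
    (hg : H.IsModel G fun w => {v | g v = w}) : H.IsMinor G := by
  induction hn : Nat.card V using Nat.strong_induction_on generalizing V with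
  | _ n ih =>
    by_cases hinj : Function.Injective g
    · refine .of_bijective (.ofBijective g ⟨hinj, fun w => (hg.1 w).1⟩) fun a b hab => ?_
      obtain ⟨p, hp, q, hq, hpq⟩ := hg.2 _ _ hab
      obtain rfl := hinj hp
      obtain rfl := hinj hq
      exact hpq
    · simp only [Function.Injective, not_forall] at hinj
      obtain ⟨a, b, hab, hne⟩ := hinj
      obtain ⟨x, hx, y, hy, hxa, hya, hxy⟩ :=
        (hg.1 (g a)).2 {a} ⟨a, rfl, rfl⟩ ⟨b, hab.symm, fun h => hne h.symm⟩
      have hgxy : g x = g y := hx.trans hy.symm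
      let g' : Option {v : V // v ≠ x ∧ v ≠ y} → W := fun v => v.elim (g x) fun v => g v
      have hg' : ∀ v, g' (contractProj x y v) = g v := by
        intro v
        rcases hv : contractProj x y v with _ | z
        · rcases contractProj_eq_none hv with rfl | rfl
          · rfl
          · exact hgxy
        · rw [contractProj_eq_some hv]
          rfl
      have hpre : ∀ w, contractProj x y ⁻¹' {v | g' v = w} = {v | g v = w} := by
        intro w
        ext v
        simp [hg']
      refine .contractEdge x y hxy (ih _ ?_ (g := g') ⟨fun w => ?_, fun w w' h => ?_⟩ rfl)
      · rw [← hn]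
        refine lt_of_le_of_ne (Nat.card_le_card_of_surjective _ (contractProj_surjective x y))
          fun hcard => hxy.ne ?_
        have hbij := (Nat.bijective_iff_surjective_and_card _).mpr
          ⟨contractProj_surjective x y, hcard.symm⟩
        exact hbij.1 ((contractProj_left x y).trans (contractProj_right x y).symm)
      · exact .of_preimage_contractProj G (by rw [hpre]; exact hg.1 w)
      · refine .of_preimage_contractProj ?_ (by rw [hpre, hpre]; exact hg.2 w w' h)
        rw [Set.disjoint_left]
        exact fun v hv hv' => h.ne (hv.symm.trans hv')

/-! ### Consequences of connectivity -/

theorem IsKConnected.setConnected_univ {G : SimpleGraph V} {k : ℕ} (hk : k ≠ 0)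
    (hG : G.IsKConnected k) : G.SetConnected Set.univ := by
  have : Nat.card V ≠ 0 := by have := hG.1; omega
  refine ⟨@Set.univ_nonempty V (Nat.card_ne_zero.mp this).1, ?_⟩
  rintro A ⟨a, -, ha⟩ ⟨b, -, hb⟩
  obtain ⟨P, -⟩ := hG.2 a b fun h => hb (h ▸ ha)
  obtain ⟨d, -, h1, h2⟩ := (P ⟨0, by omega⟩ : G.Walk a b).exists_boundary_dart A ha hb
  exact ⟨d.fst, trivial, d.snd, trivial, h1, h2, d.adj⟩

/-- In a `3`-connected graph no two vertices separate a set from the rest. -/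
theorem IsKConnected.not_separated {G : SimpleGraph V} (hG : G.IsKConnected 3) {C : Set V}
    {p q x y : V} (hx : x ∈ C) (hyC : y ∉ C) (hyp : y ≠ p) (hyq : y ≠ q)
    (hC : ∀ a ∈ C, ∀ b ∉ C, G.Adj a b → b = p ∨ b = q) : False := by
  obtain ⟨P, -, hP⟩ := hG.2 x y fun h => hyC (h ▸ hx)
  have hdart : ∀ i, ∃ b ∈ (P i : G.Walk x y).support, b ∉ C ∧ (b = p ∨ b = q) := by
    intro i
    obtain ⟨d, hd, h1, h2⟩ := (P i : G.Walk x y).exists_boundary_dart C hx hyC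
    exact ⟨d.snd, Walk.dart_snd_mem_support_of_mem_darts _ hd, h2, hC _ h1 _ h2 d.adj⟩
  choose b hb hbC hbpq using hdart
  -- The exit vertices of the three paths are neither `x` nor `y`, so they are distinct; yet all lie
  -- in `{p, q}`.
  have hdist : ∀ i j, i ≠ j → b i ≠ b j := by
    intro i j hij h
    rcases hP i j hij (b i) (hb i) (h ▸ hb j) with h | h
    · exact hbC i (h ▸ hx)
    · exact (hbpq i).elim (fun h' => hyp (h.symm.trans h')) fun h' => hyq (h.symm.trans h')
  have h01 := hdist 0 1 (by decide)
  have h02 := hdist 0 2 (by decide)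
  have h12 := hdist 1 2 (by decide)
  rcases hbpq 0 with h0 | h0 <;> rcases hbpq 1 with h1 | h1 <;> rcases hbpq 2 with h2 | h2 <;>
    simp_all

/-! ### Spanning `K₆`-models -/

section CompleteModel

variable {G : SimpleGraph V} {f : V → Fin 6} {i : Fin 6}

open Classical in
/-- The branch sets other than that of `i` which are joined to `X`. -/
noncomputable def seenLabels (G : SimpleGraph V) (f : V → Fin 6) (i : Fin 6) (X : Set V) :
    Finset (Fin 6) :=
  {j | j ≠ i ∧ G.Sees X {v | f v = j}}

theorem mem_seenLabels {X : Set V} {j : Fin 6} :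
    j ∈ seenLabels G f i X ↔ j ≠ i ∧ G.Sees X {v | f v = j} := by
  simp [seenLabels]

theorem seenLabels_union (X Y : Set V) :
    seenLabels G f i (X ∪ Y) = seenLabels G f i X ∪ seenLabels G f i Y := by
  ext j
  simp only [Finset.mem_union, mem_seenLabels, sees_union_left]
  tauto

theorem seenLabels_fiber (hf : (completeGraph (Fin 6)).IsModel G fun w => {v | f v = w}) :
    seenLabels G f i {v | f v = i} = Finset.univ.erase i := by
  ext j
  simp only [mem_seenLabels, Finset.mem_erase, Finset.mem_univ, and_true, and_iff_left_iff_imp]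
  exact fun h => hf.2 i j h.symm

theorem exists_equiv_sum_of_card {α : Type*} [Fintype α] [DecidableEq α] {m n : ℕ}
    (T : Finset α) (hT : T.card = n) (hα : Fintype.card α = m + n) :
    ∃ e : α ≃ Fin m ⊕ Fin n, ∀ a, (∃ j, e a = Sum.inr j) ↔ a ∈ T := by
  have e₁ : {a // a ∈ T} ≃ Fin n := Fintype.equivFinOfCardEq (by simpa using hT)
  have e₂ : {a // ¬ a ∈ T} ≃ Fin m := Fintype.equivFinOfCardEq (by
    rw [Fintype.card_subtype_compl, Fintype.card_coe]; omega)
  refine ⟨((Equiv.sumCompl (· ∈ T)).symm.trans (e₁.sumCongr e₂)).trans (Equiv.sumComm _ _), ?_⟩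
  intro a
  by_cases ha : a ∈ T
  · simp [ha]
  · simp [ha]

/-- Dividing a branch set of a `K₆`-model into a part joined to two branch sets and a part joined
to the other three gives a `K₃,₄`-model. -/
theorem IsModel.isMinor_of_split_card_eq_two [Finite V]
    (hf : (completeGraph (Fin 6)).IsModel G fun w => {v | f v = w})
    {C : Set V} (hCi : C ⊆ {v | f v = i}) (hC : G.SetConnected C)
    (hD : G.SetConnected ({v | f v = i} \ C)) (S : Finset (Fin 6)) (hS : S.card = 2)
    (hSC : S ⊆ seenLabels G f i C)
    (hSD : ∀ j ≠ i, j ∉ S → j ∈ seenLabels G f i ({v | f v = i} \ C)) :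
    (completeBipartiteGraph (Fin 3) (Fin 4)).IsMinor G := by
  classical
  have hiS : i ∉ S := fun h => (mem_seenLabels.mp (hSC h)).1 rfl
  -- Of the seven labels, `none` stands for `C` and `some i` for the rest of its branch set. The
  -- side of four is `C` with the three sets outside `S`; the side of three is that rest with the
  -- two sets in `S`.
  obtain ⟨e, he⟩ := exists_equiv_sum_of_card (m := 3) (n := 4)
    (Finset.insertNone ((insert i S)ᶜ)) (by
      rw [Finset.card_insertNone, Finset.card_compl, Finset.card_insert_of_notMem hiS, hS]
      rfl) (by simp)
  let g : V → Option (Fin 6) := fun v => if v ∈ C then none else some (f v)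
  have hnone : {v | g v = none} = C := by
    ext v
    simp [g]
  have hi : {v | g v = some i} = {v | f v = i} \ C := by
    ext v
    simp [g, and_comm]
  have hj : ∀ j ≠ i, {v | g v = some j} = {v | f v = j} := by
    intro j hj
    ext v
    simp only [g, Set.mem_ofPred_eq]
    split_ifs with hv
    · have : f v = i := hCi hv
      simp [this, hj.symm]
    · simp
  have hconn : ∀ o, G.SetConnected {v | g v = o} := by
    rintro (_ | j)
    · rwa [hnone]
    · by_cases h : j = i
      · subst h
        rwa [hi]
      · rw [hj j h]
        exact hf.1 j
  have hsees : ∀ o o', (∃ j, e o = Sum.inr j) → (¬ ∃ j, e o' = Sum.inr j) →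
      G.Sees {v | g v = o} {v | g v = o'} := by
    intro o o' ho ho'
    rw [he] at ho ho'
    rcases o' with _ | k
    · simp at ho'
    have hk : k = i ∨ k ∈ S := by simpa [or_iff_not_imp_left] using ho'
    rcases o with _ | j
    · rw [hnone]
      rcases hk with rfl | hk
      · rw [hi]
        exact (hf.1 k).sees_diff hCi hC.1 hD.1
      · rw [hj k fun h => hiS (h ▸ hk)]
        exact (mem_seenLabels.mp (hSC hk)).2
    · have hjS : j ≠ i ∧ j ∉ S := by simpa using ho
      rw [hj j hjS.1]
      rcases hk with rfl | hk
      · rw [hi]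
        exact (mem_seenLabels.mp (hSD j hjS.1 hjS.2)).2.symm
      · rw [hj k fun h => hiS (h ▸ hk)]
        exact hf.2 j k fun h => hjS.2 (h ▸ hk)
  have heq : ∀ w, {v | e (g v) = w} = {v | g v = e.symm w} := by
    intro w
    ext v
    simp [Equiv.eq_symm_apply]
  refine IsModel.isMinor (g := fun v => e (g v)) ⟨fun w => ?_, fun w w' h => ?_⟩
  · beta_reduce
    rw [heq]
    exact hconn _
  · beta_reduce
    rw [heq, heq]
    rcases w with w | w <;> rcases w' with w' | w' <;> simp at h
    · exact (hsees _ _ (by simp) (by simp)).symm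
    · exact hsees _ _ (by simp) (by simp)

theorem IsModel.seenLabels_union_diff
    (hf : (completeGraph (Fin 6)).IsModel G fun w => {v | f v = w})
    {C : Set V} (hCi : C ⊆ {v | f v = i}) :
    seenLabels G f i C ∪ seenLabels G f i ({v | f v = i} \ C) = Finset.univ.erase i := by
  rw [← seenLabels_union, Set.union_sdiff_cancel hCi, seenLabels_fiber hf]

/-- Together the parts see five labels, so if each sees at least two, one sees at least three. The
at most two labels it misses are seen by the other part and extend to the pair `S` needed for a
`K₃,₄`. -/
theorem IsModel.isMinor_or_card_le_one [Finite V]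
    (hf : (completeGraph (Fin 6)).IsModel G fun w => {v | f v = w})
    {C : Set V} (hCi : C ⊆ {v | f v = i}) (hC : G.SetConnected C)
    (hD : G.SetConnected ({v | f v = i} \ C)) :
    (completeBipartiteGraph (Fin 3) (Fin 4)).IsMinor G ∨ (seenLabels G f i C).card ≤ 1 ∨
      (seenLabels G f i ({v | f v = i} \ C)).card ≤ 1 := by
  classical
  by_contra! hcon
  obtain ⟨hminor, h1, h2⟩ := hcon
  have key : ∀ C : Set V, C ⊆ {v | f v = i} → G.SetConnected C →
      G.SetConnected ({v | f v = i} \ C) → 1 < (seenLabels G f i C).card →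
      (seenLabels G f i ({v | f v = i} \ C)).card < 3 := by
    intro C hCi hC hD h1
    by_contra! h3
    have hun := hf.seenLabels_union_diff hCi
    have hsub : Finset.univ.erase i \ seenLabels G f i ({v | f v = i} \ C) ⊆
        seenLabels G f i C := by
      rw [← hun, Finset.union_sdiff_right]
      exact Finset.sdiff_subset
    have hcard : (Finset.univ.erase i \ seenLabels G f i ({v | f v = i} \ C)).card ≤ 2 := by
      rw [Finset.card_sdiff_of_subset (hun ▸ Finset.subset_union_right)]
      simp
      omega
    obtain ⟨S, hS1, hS2, hS⟩ := Finset.exists_subsuperset_card_eq hsub hcard h1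
    refine hminor (hf.isMinor_of_split_card_eq_two hCi hC hD S hS hS2 fun j hj hjS => ?_)
    by_contra hjD
    exact hjS (hS1 (by simp [hj, hjD]))
  have h3 := key C hCi hC hD h1
  have h4 := key ({v | f v = i} \ C) Set.sdiff_subset hD
    (by rwa [Set.sdiff_sdiff_cancel_left hCi]) h2
  rw [Set.sdiff_sdiff_cancel_left hCi] at h4
  have h5 := Finset.card_union_le (seenLabels G f i C) (seenLabels G f i ({v | f v = i} \ C))
  rw [hf.seenLabels_union_diff hCi] at h5
  simp at h5
  omega

/-- A connected part of a branch set that is joined to only one other branch set can be moved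
there. -/
theorem IsModel.exists_move
    (hf : (completeGraph (Fin 6)).IsModel G fun w => {v | f v = w}) {j : Fin 6} (hij : i ≠ j)
    {D : Set V} (hDj : D ⊆ {v | f v = j}) (hD : G.SetConnected D)
    (hD' : G.SetConnected ({v | f v = j} \ D)) (hDi : seenLabels G f j D = {i}) :
    ∃ f' : V → Fin 6, ((completeGraph (Fin 6)).IsModel G fun w => {v | f' v = w}) ∧
      {v | f' v = i} = {v | f v = i} ∪ D := by
  classical
  let f' : V → Fin 6 := fun v => if v ∈ D then i else f v
  have hi : {v | f' v = i} = {v | f v = i} ∪ D := by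
    ext v
    by_cases hv : v ∈ D <;> simp [f', hv]
  have hj : {v | f' v = j} = {v | f v = j} \ D := by
    ext v
    by_cases hv : v ∈ D <;> simp [f', hv, hij]
  have hk : ∀ k, k ≠ i → k ≠ j → {v | f' v = k} = {v | f v = k} := by
    intro k hki hkj
    ext v
    by_cases hv : v ∈ D
    · have : f v = j := hDj hv
      simp [f', hv, this, hki.symm, hkj.symm]
    · simp [f', hv]
  have hsub : ∀ k, k ≠ j → {v | f v = k} ⊆ {v | f' v = k} := by
    intro k hkj
    by_cases hki : k = i
    · subst hki
      rw [hi]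
      exact Set.subset_union_left
    · rw [hk k hki hkj]
  have hseesD : G.Sees D {v | f v = i} :=
    (mem_seenLabels.mp (hDi ▸ Finset.mem_singleton_self i)).2
  have hseesj : ∀ k, k ≠ j → G.Sees {v | f' v = j} {v | f' v = k} := by
    intro k hkj
    by_cases hki : k = i
    · subst hki
      rw [hi, hj]
      exact ((hf.1 j).sees_diff hDj hD.1 hD'.1).symm.mono subset_rfl Set.subset_union_right
    -- As `D` sees only `i`, the edge to `k` must leave from the remaining part.
    · have h : G.Sees {v | f v = j} {v | f v = k} := hf.2 j k hkj.symm
      rw [← Set.union_sdiff_cancel hDj, sees_union_left] at h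
      rw [hj, hk k hki hkj]
      refine h.resolve_left fun h => hki ?_
      rw [← Finset.mem_singleton, ← hDi]
      exact mem_seenLabels.mpr ⟨hkj, h⟩
  refine ⟨f', ⟨fun k => ?_, fun k k' h => ?_⟩, hi⟩
  · by_cases hki : k = i
    · subst hki
      beta_reduce
      rw [hi]
      exact (hf.1 k).union hD hseesD.symm
    · by_cases hkj : k = j
      · subst hkj
        beta_reduce
        rwa [hj]
      · beta_reduce
        rw [hk k hki hkj]
        exact hf.1 k
  · have hne : k ≠ k' := h
    by_cases hkj : k = j
    · subst hkj
      exact hseesj k' hne.symm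
    · by_cases hkj' : k' = j
      · subst hkj'
        exact (hseesj k hkj).symm
      · exact (hf.2 k k' h).mono (hsub k hkj) (hsub k' hkj')

/-- If the branch set of `i` is as large as possible, then it has only one neighbour in each of the
other branch sets. -/
theorem IsModel.neighbor_unique [Finite V]
    (hf : (completeGraph (Fin 6)).IsModel G fun w => {v | f v = w})
    (hminor : ¬ (completeBipartiteGraph (Fin 3) (Fin 4)).IsMinor G)
    (hmax : ∀ f' : V → Fin 6, ((completeGraph (Fin 6)).IsModel G fun w => {v | f' v = w}) →
      {v | f' v = i}.ncard ≤ {v | f v = i}.ncard)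
    {a b u v : V} (ha : f a = i) (hb : f b = i) (huv : f u = f v) (hui : f u ≠ i)
    (hau : G.Adj a u) (hbv : G.Adj b v) : u = v := by
  by_contra hne
  -- A part that sees `i` and nothing else could be moved to `i`, against maximality.
  have key : ∀ D ⊆ {x | f x = f u}, G.SetConnected D → G.SetConnected ({x | f x = f u} \ D) →
      (∃ d ∈ D, ∃ c, f c = i ∧ G.Adj c d) → 1 < (seenLabels G f (f u) D).card := by
    rintro D hDj hD hD' ⟨d, hd, c, hc, hcd⟩
    by_contra! hcard
    have hi : i ∈ seenLabels G f (f u) D := mem_seenLabels.mpr ⟨hui.symm, d, hd, c, hc, hcd.symm⟩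
    obtain ⟨f', hf', hfi⟩ := hf.exists_move hui.symm hDj hD hD'
      (Finset.eq_singleton_iff_unique_mem.mpr
        ⟨hi, fun k hk => Finset.card_le_one.mp hcard k hk i hi⟩)
    have hlt : {x | f x = i}.ncard < {x | f' x = i}.ncard := by
      rw [hfi]
      refine Set.ncard_lt_ncard ⟨Set.subset_union_left, fun h => hui ?_⟩ (Set.toFinite _)
      exact (hDj hd).symm.trans (h (Or.inr hd))
    exact absurd (hmax f' hf') (not_le.mpr hlt)
  obtain ⟨C, hCj, huC, hvC, hC, hC'⟩ := (hf.1 (f u)).exists_split (u := u) (v := v) rfl huv.symm hne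
  rcases hf.isMinor_or_card_le_one hCj hC hC' with h | h | h
  · exact hminor h
  · exact absurd (key C hCj hC hC' ⟨u, huC, a, ha, hau⟩) (not_lt.mpr h)
  · refine absurd (key _ Set.sdiff_subset hC' ?_ ⟨v, ⟨huv.symm, hvC⟩, b, hb, hbv⟩) (not_lt.mpr h)
    rwa [Set.sdiff_sdiff_cancel_left hCj]

/-- A branch set with at least two vertices contains a connected part that is joined to at most one
other branch set and has at most one neighbour in its own branch set. -/
theorem IsModel.exists_part [Finite V]
    (hf : (completeGraph (Fin 6)).IsModel G fun w => {v | f v = w})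
    (hminor : ¬ (completeBipartiteGraph (Fin 3) (Fin 4)).IsMinor G)
    {x y : V} (hx : f x = i) (hy : f y = i) (hxy : x ≠ y) :
    ∃ C ⊆ {v | f v = i}, C.Nonempty ∧ (seenLabels G f i C).card ≤ 1 ∧
      ∃ p, f p = i ∧ ∀ a ∈ C, ∀ b ∉ C, f b = i → G.Adj a b → b = p := by
  classical
  have hne : {C : Set V | C ⊆ {v | f v = i} ∧ G.SetConnected C ∧
      G.SetConnected ({v | f v = i} \ C) ∧ (seenLabels G f i C).card ≤ 1}.Nonempty := by
    obtain ⟨C, hCi, -, -, hC, hC'⟩ := (hf.1 i).exists_split hx hy hxy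
    rcases hf.isMinor_or_card_le_one hCi hC hC' with h | h | h
    · exact absurd h hminor
    · exact ⟨C, hCi, hC, hC', h⟩
    · exact ⟨_, Set.sdiff_subset, hC', by rwa [Set.sdiff_sdiff_cancel_left hCi], h⟩
  obtain ⟨C, ⟨hCi, hC, hC', hcard⟩, hmax⟩ := Set.Finite.exists_maximal (Set.toFinite _) hne
  refine ⟨C, hCi, hC.1, hcard, ?_⟩
  by_contra! hcon
  obtain ⟨p₀, hp₀⟩ := hC'.1
  -- The choice of `p₀` is irrelevant: it only yields a first neighbour `u` of `C`, and then `hcon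
  -- u` yields a second.
  obtain ⟨a, ha, u, huC, hui, hau, -⟩ := hcon p₀ hp₀.1
  obtain ⟨b, hb, v, hvC, hvi, hbv, hvu⟩ := hcon u hui
  have grow : ∀ E ⊆ {v | f v = i} \ C, G.SetConnected E →
      G.SetConnected (({v | f v = i} \ C) \ E) → G.Sees C E →
      -- Since `C` is maximal, `C ∪ E` sees more than one label, so its complement sees at most one.
      (seenLabels G f i (({v | f v = i} \ C) \ E)).card ≤ 1 := by
    intro E hE hEc hEc' hsees
    have hsub : C ∪ E ⊆ {v | f v = i} := Set.union_subset hCi (hE.trans Set.sdiff_subset)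
    rw [Set.sdiff_sdiff] at hEc' ⊢
    rcases hf.isMinor_or_card_le_one hsub (hC.union hEc hsees) hEc' with h | h | h
    · exact absurd h hminor
    · have := hmax ⟨hsub, hC.union hEc hsees, hEc', h⟩ Set.subset_union_left
      obtain ⟨z, hz⟩ := hEc.1
      exact absurd (this (Or.inr hz)) (hE hz).2
    · exact h
  obtain ⟨E, hE, huE, hvE, hEc, hEc'⟩ := hC'.exists_split ⟨hui, huC⟩ ⟨hvi, hvC⟩ hvu.symm
  have h1 := grow E hE hEc hEc' ⟨a, ha, u, huE, hau⟩
  have h2 := grow _ Set.sdiff_subset hEc' (by rwa [Set.sdiff_sdiff_cancel_left hE])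
    ⟨b, hb, v, ⟨⟨hvi, hvC⟩, hvE⟩, hbv⟩
  rw [Set.sdiff_sdiff_cancel_left hE] at h2
  -- The branch set is now cut into three parts seeing at most one label each, but five must be
  -- seen.
  have hun := hf.seenLabels_union_diff hCi
  rw [← Set.union_sdiff_cancel hE, seenLabels_union] at hun
  have h3 := Finset.card_union_le (seenLabels G f i C)
    (seenLabels G f i E ∪ seenLabels G f i (({v | f v = i} \ C) \ E))
  have h4 := Finset.card_union_le (seenLabels G f i E)
    (seenLabels G f i (({v | f v = i} \ C) \ E))
  rw [hun] at h3
  simp at h3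
  omega

theorem IsModel.injective_of_maximal [Finite V] (hG : G.IsKConnected 3)
    (hf : (completeGraph (Fin 6)).IsModel G fun w => {v | f v = w})
    (hminor : ¬ (completeBipartiteGraph (Fin 3) (Fin 4)).IsMinor G)
    (hmax : ∀ f' : V → Fin 6, ((completeGraph (Fin 6)).IsModel G fun w => {v | f' v = w}) →
      {v | f' v = i}.ncard ≤ {v | f v = i}.ncard)
    {x y : V} (hx : f x = i) (hy : f y = i) : x = y := by
  by_contra hxy
  obtain ⟨C, hCi, ⟨c, hc⟩, hcard, p, hpi, hp⟩ := hf.exists_part hminor hx hy hxy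
  -- If `C` sees no label, `j` is arbitrary and may even equal `i`.
  obtain ⟨j, hj⟩ : ∃ j, seenLabels G f i C ⊆ {j} := Finset.card_le_one_iff_subset_singleton.mp hcard
  obtain ⟨q, hqj, hq⟩ : ∃ q, f q = j ∧ ∀ a ∈ C, ∀ b, f b ≠ i → G.Adj a b → b = q := by
    have hlabel : ∀ a ∈ C, ∀ b, f b ≠ i → G.Adj a b → f b = j := fun a ha b hb hab =>
      Finset.mem_singleton.mp (hj (mem_seenLabels.mpr ⟨hb, a, ha, b, rfl, hab⟩))
    by_cases hex : ∃ a ∈ C, ∃ b, f b ≠ i ∧ G.Adj a b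
    · obtain ⟨a, ha, b, hb, hab⟩ := hex
      refine ⟨b, hlabel a ha b hb hab, fun a' ha' b' hb' hab' => ?_⟩
      exact hf.neighbor_unique hminor hmax (hCi ha') (hCi ha)
        ((hlabel a' ha' b' hb' hab').trans (hlabel a ha b hb hab).symm) hb' hab' hab
    · push Not at hex
      obtain ⟨q, hq⟩ := (hf.1 j).1
      exact ⟨q, hq, fun a ha b hb hab => absurd hab (hex a ha b hb)⟩
  -- A further branch set supplies a vertex outside `C` other than `p` and `q`.
  obtain ⟨k, hk⟩ : ∃ k : Fin 6, k ∉ ({i, j} : Finset (Fin 6)) := by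
    by_contra! h
    have h1 := Finset.card_le_card (fun k _ => h k : Finset.univ ⊆ ({i, j} : Finset (Fin 6)))
    have h2 := Finset.card_le_two (a := i) (b := j)
    simp at h1
    omega
  have hki : k ≠ i := fun h => hk (by simp [h])
  have hkj : k ≠ j := fun h => hk (by simp [h])
  obtain ⟨z, hz⟩ := (hf.1 k).1
  have hz : f z = k := hz
  refine hG.not_separated (p := p) (q := q) (y := z) hc
    (fun h => hki (hz.symm.trans (hCi h))) (fun h => hki ?_) (fun h => hkj ?_)
    fun a ha b hb hab => ?_
  · rw [← hz, h, hpi]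
  · rw [← hz, h, hqj]
  · by_cases hbi : f b = i
    · exact Or.inl (hp a ha b hb hbi hab)
    · exact Or.inr (hq a ha b hbi hab)

end CompleteModel

/-! ### Conclusion -/

theorem IsKConnected.isMinor_or_iso_of_isModel [Finite V] {G : SimpleGraph V}
    (hG : G.IsKConnected 3) {f : V → Fin 6}
    (hf : (completeGraph (Fin 6)).IsModel G fun w => {v | f v = w}) :
    (completeBipartiteGraph (Fin 3) (Fin 4)).IsMinor G ∨
      Nonempty (G ≃g completeGraph (Fin 6)) := by
  by_cases hminor : (completeBipartiteGraph (Fin 3) (Fin 4)).IsMinor G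
  · exact Or.inl hminor
  -- Maximising over model and label together makes the bound on the fibre of `i` apply to every
  -- fibre of `g`.
  obtain ⟨⟨g, i⟩, hg, hmax⟩ := Set.exists_max_image
    {q : (V → Fin 6) × Fin 6 | (completeGraph (Fin 6)).IsModel G fun w => {v | q.1 v = w}}
    (fun q => {v | q.1 v = q.2}.ncard) (Set.toFinite _) ⟨(f, 0), hf⟩
  have hg : (completeGraph (Fin 6)).IsModel G fun w => {v | g v = w} := hg
  have hone : {v | g v = i}.ncard ≤ 1 := (Set.ncard_le_one (Set.toFinite _)).mpr
    fun a ha b hb => hg.injective_of_maximal hG hminor (fun f' hf' => hmax (f', i) hf') ha hb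
  have hinj : Function.Injective g := by
    intro a b hab
    exact (Set.ncard_le_one (Set.toFinite _)).mp ((hmax (g, g b) hg).trans hone) a hab b rfl
  refine Or.inr ⟨⟨Equiv.ofBijective g ⟨hinj, fun w => (hg.1 w).1⟩, fun {a b} => ⟨fun h => ?_, ?_⟩⟩⟩
  · obtain ⟨p, hp, q, hq, hpq⟩ := hg.2 (g a) (g b) h
    obtain rfl := hinj hp
    obtain rfl := hinj hq
    exact hpq
  · exact fun h h' => h.ne (hinj h')

end SimpleGraph

theorem mainTheorem9 {V : Type*} [Finite V] (G : SimpleGraph V) (hG : G.IsKConnected 3)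
    (hminor : (completeBipartiteGraph (Fin 3) (Fin 4)).IsMinor G ∨
      (SimpleGraph.completeGraph (Fin 6)).IsMinor G) :
    (completeBipartiteGraph (Fin 3) (Fin 4)).IsMinor G ∨
      Nonempty (G ≃g SimpleGraph.completeGraph (Fin 6)) := by
  rcases hminor with h | h
  · exact Or.inl h
  · obtain ⟨f, hf⟩ := h.exists_isModel
    obtain ⟨g, hg⟩ := hf.exists_spanning (hG.setConnected_univ three_ne_zero)
    exact hG.isMinor_or_iso_of_isModel hg
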